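/- Let $K$ and $H$ be complex Hilbert spaces (inner products linear in the first variable), let $\mathcal{H}=K\otimes H$ be their Hilbert tensor product (the completion of the algebraic tensor product), and fix an operator class $\mathcal{B}_\mu\in\{\mathcal{B}_1,\mathcal{B}_2,\mathcal{B}\}$: the trace class operators with the trace norm, the Hilbert--Schmidt operators with the Hilbert--Schmidt norm, or the bounded operators with the operator norm; write $\|\cdot\|_\mu$ for its norm. Let $T\in\mathcal{B}_\mu(\mathcal{H})$. For $u,v\in K$ the identity $$\langle T_{u,v}\eta,\xi\rangle_H=\langle T(v\otimes\eta),u\otimes\xi\rangle_{\mathcal{H}}\qquad(\xi,\eta\in H)$$ defines a unique map $T_{u,v}:H\to H$, and $T_{u,v}=J_u^*TJ_v$, where $J_u:H\to\mathcal{H}$ is the bounded operator $J_u\xi=u\otimes\xi$. Moreover: 1. (Slicing.) For all $u,v\in K$ we have $T_{u,v}\in\mathcal{B}_\mu(H)$ and $\|T_{u,v}\|_\mu\le\|T\|_\mu\,\|u\|\,\|v\|$. The map $(u,v)\mapsto T_{u,v}$ is conjugate-linear in $u$, linear in $v$, and jointly bounded $K\times K\to\mathcal{B}_\mu(H)$.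 If $T^{(n)}\in\mathcal{B}_\mu(\mathcal{H})$ for $n\ge1$ and $T=\sum_{n=1}^\infty T^{(n)}$ with convergence in $\mathcal{B}_\mu(\mathcal{H})$, then for all $u,v\in K$ we have $T_{u,v}=\sum_{n=1}^\infty T^{(n)}_{u,v}$ with convergence in $\mathcal{B}_\mu(H)$. 2. (Stitching.) Let $\{e_i\}_{i\in I}$ be an orthonormal basis of $K$ and put $T_{ij}=T_{e_i,e_j}$. For every finite $F\subset I$ and $y_j\in H$ $(j\in F)$ the series in $$Q\Big[\sum_{j\in F}e_j\otimes y_j\Big]:=\sum_{i\in I}e_i\otimes\Big[\sum_{j\in F}T_{ij}(y_j)\Big]$$ converges in $\mathcal{H}$; the map $Q$ so defined on finite sums extends uniquely to a bounded linear operator on $\mathcal{H}$, and this extension is $Q=T$. In particular $Q\in\mathcal{B}_\mu(\mathcal{H})$ and $\|Q\|_\mu=\|T\|_\mu$. -/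

import Mathlib

open scoped TensorProduct ENNReal ComplexConjugate

noncomputable section

namespace HilbertSlicing

universe u v w

/-! ### Trace class, Hilbert--Schmidt and bounded operators -/

section Classes

variable {E : Type u} [NormedAddCommGroup E] [InnerProductSpace ℂ E] [CompleteSpace E]
variable {F : Type v} [NormedAddCommGroup F] [InnerProductSpace ℂ F] [CompleteSpace F]

variable (E) in
/-- The index set of a fixed orthonormal basis of `E`. -/
def basisSet : Set E := Classical.choose (exists_hilbertBasis ℂ E)

variable (E) in
/-- A fixed orthonormal (Hilbert) basis of `E`. The norms below do not depend on this choice, see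
`hsENorm_eq` and `traceENorm_eq`. -/
def someBasis : HilbertBasis (basisSet E) ℂ E :=
  Classical.choose (Classical.choose_spec (exists_hilbertBasis ℂ E))

/-- The Hilbert--Schmidt norm `(∑ᵢ ‖A eᵢ‖²)^(1/2)`, with value `∞` if the sum diverges. -/
def hsENorm (A : E →L[ℂ] F) : ℝ≥0∞ :=
  (∑' i, ‖A (someBasis E i)‖ₑ ^ 2) ^ (1 / 2 : ℝ)

/-- The absolute value `|A| = (A* A)^(1/2)`. -/
def opAbs (A : E →L[ℂ] F) : E →L[ℂ] E :=
  CFC.sqrt (ContinuousLinearMap.adjoint A ∘L A)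

/-- The trace norm `Tr |A| = ∑ᵢ ⟨|A| eᵢ, eᵢ⟩`, with value `∞` if the sum diverges. -/
def traceENorm (A : E →L[ℂ] F) : ℝ≥0∞ :=
  ∑' i, ENNReal.ofReal (RCLike.re (inner ℂ (someBasis E i) (opAbs A (someBasis E i))))

/-- The three operator classes: trace class, Hilbert--Schmidt, bounded. -/
inductive OperatorClass
  | traceClass
  | hilbertSchmidt
  | bounded

/-- The norm of the operator class `μ` as an extended nonnegative number; it is `∞` exactly on the
bounded operators that are not in the class. -/
def classENorm (μ : OperatorClass) (A : E →L[ℂ] F) : ℝ≥0∞ :=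
  match μ with
  | OperatorClass.traceClass => traceENorm A
  | OperatorClass.hilbertSchmidt => hsENorm A
  | OperatorClass.bounded => ‖A‖ₑ

/-- Membership of a bounded operator `A : E → F` in the class `μ`. -/
def MemClass (μ : OperatorClass) (A : E →L[ℂ] F) : Prop :=
  classENorm μ A < ∞

/-- The norm of the class `μ` as a real number (meaningful for members of the class). -/
def classNorm (μ : OperatorClass) (A : E →L[ℂ] F) : ℝ :=
  (classENorm μ A).toReal

/-- `A = ∑ₙ Aₙ` with convergence of the partial sums in the norm of the class `μ`. -/
def SeriesConverges (μ : OperatorClass) (A' : ℕ → E →L[ℂ] F) (A : E →L[ℂ] F) : Prop :=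
  Filter.Tendsto (fun N => classENorm μ (A - ∑ n ∈ Finset.range N, A' n))
    Filter.atTop (nhds 0)

/-! Independence of the norms of the chosen orthonormal basis. -/

theorem parseval_enorm {ι : Type w} (b : HilbertBasis ι ℂ E) (x : E) :
    ∑' i, ‖inner ℂ (b i) x‖ₑ ^ 2 = ‖x‖ₑ ^ 2 := by
  have h := b.hasSum_inner_mul_inner x x
  have h2 : HasSum (fun i => ‖inner ℂ (b i) x‖ ^ 2) (‖x‖ ^ 2) := by
    have h3 := Complex.hasSum_re h
    have e1 : (inner ℂ x x : ℂ).re = ‖x‖ ^ 2 := by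
      rw [inner_self_eq_norm_sq_to_K]; norm_cast
    have e2 : ∀ i, (inner ℂ x (b i) * inner ℂ (b i) x : ℂ).re = ‖inner ℂ (b i) x‖ ^ 2 := by
      intro i
      rw [← inner_conj_symm, RCLike.conj_mul]; norm_cast
    simpa only [e1, e2] using h3
  have h4 := ENNReal.ofReal_tsum_of_nonneg (fun i => by positivity) h2.summable
  rw [h2.tsum_eq] at h4
  simp only [ENNReal.ofReal_pow (norm_nonneg _), ofReal_norm] at h4
  exact h4.symm

theorem tsum_enorm_adjoint {ι : Type w} {κ : Type*} (b : HilbertBasis ι ℂ E)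
    (c : HilbertBasis κ ℂ F) (A : E →L[ℂ] F) :
    ∑' i, ‖A (b i)‖ₑ ^ 2 = ∑' k, ‖ContinuousLinearMap.adjoint A (c k)‖ₑ ^ 2 := by
  simp_rw [← parseval_enorm c (A _), ← parseval_enorm b (ContinuousLinearMap.adjoint A _)]
  rw [ENNReal.tsum_comm]
  refine tsum_congr fun k => tsum_congr fun i => ?_
  rw [ContinuousLinearMap.adjoint_inner_right, ← inner_conj_symm, RCLike.enorm_conj]

theorem hsENorm_eq {ι : Type w} (b : HilbertBasis ι ℂ E) (A : E →L[ℂ] F) :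
    hsENorm A = (∑' i, ‖A (b i)‖ₑ ^ 2) ^ (1 / 2 : ℝ) := by
  rw [hsENorm, tsum_enorm_adjoint (someBasis E) (someBasis F), tsum_enorm_adjoint b (someBasis F)]

theorem traceENorm_eq {ι : Type w} (b : HilbertBasis ι ℂ E) (A : E →L[ℂ] F) :
    traceENorm A = ∑' i, ENNReal.ofReal (RCLike.re (inner ℂ (b i) (opAbs A (b i)))) := by
  have hpos : 0 ≤ opAbs A := CFC.sqrt_nonneg _
  set R : E →L[ℂ] E := CFC.sqrt (opAbs A) with hR
  have hRR : R * R = opAbs A := CFC.sqrt_mul_sqrt_self (opAbs A) hpos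
  have hRs : ContinuousLinearMap.adjoint R = R :=
    (IsSelfAdjoint.of_nonneg (CFC.sqrt_nonneg (opAbs A))).star_eq
  have key : ∀ x : E, ENNReal.ofReal (RCLike.re (inner ℂ x (opAbs A x))) = ‖R x‖ₑ ^ 2 := by
    intro x
    rw [← hRR, mul_apply_eq_comp, ← ContinuousLinearMap.adjoint_inner_left, hRs,
      inner_self_eq_norm_sq, ENNReal.ofReal_pow (norm_nonneg _), ofReal_norm]
  simp only [traceENorm, key]
  rw [tsum_enorm_adjoint (someBasis E) (someBasis E), tsum_enorm_adjoint b (someBasis E)]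

end Classes

/-! ### Hilbert tensor product, slices and stitching -/

section Tensor

variable {K : Type u} [NormedAddCommGroup K] [InnerProductSpace ℂ K] [CompleteSpace K]
variable {H : Type v} [NormedAddCommGroup H] [InnerProductSpace ℂ H] [CompleteSpace H]

/-- The Hilbert tensor product: the completion of the algebraic tensor product for the inner
product with `⟨x₁ ⊗ y₁, x₂ ⊗ y₂⟩ = ⟨x₁, x₂⟩ ⟨y₁, y₂⟩`. -/
abbrev HTensor (K : Type u) [NormedAddCommGroup K] [InnerProductSpace ℂ K]
    (H : Type v) [NormedAddCommGroup H] [InnerProductSpace ℂ H] : Type (max u v) :=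
  UniformSpace.Completion (K ⊗[ℂ] H)

/-- The simple tensor `x ⊗ y` in the Hilbert tensor product. -/
def simpleTensor (x : K) (y : H) : HTensor K H :=
  ((x ⊗ₜ[ℂ] y : K ⊗[ℂ] H) : UniformSpace.Completion (K ⊗[ℂ] H))

/-- The operator `J_u : H → K ⊗ H`, `ξ ↦ u ⊗ ξ`. -/
def tensorLeft (u : K) : H →L[ℂ] HTensor K H :=
  UniformSpace.Completion.toComplL ∘L TensorProduct.mkL ℂ K H u

theorem tensorLeft_apply (u : K) (ξ : H) : tensorLeft u ξ = simpleTensor u ξ := rfl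

/-- The slice `T_{u,v} = J_u* T J_v : H → H`. -/
def slice (T : HTensor K H →L[ℂ] HTensor K H) (u v : K) : H →L[ℂ] H :=
  ContinuousLinearMap.adjoint (tensorLeft u) ∘L T ∘L tensorLeft v

/-- For an orthonormal basis `e` of `K` and a matrix `S` of operators on `H`, the bounded operator
`Q` extends the map given on finite sums by
`∑_{j ∈ F} eⱼ ⊗ yⱼ ↦ ∑ᵢ eᵢ ⊗ (∑_{j ∈ F} Sᵢⱼ yⱼ)`, the series over `i` being convergent. -/
def IsStitching {ι : Type w} (e : HilbertBasis ι ℂ K) (S : ι → ι → H →L[ℂ] H)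
    (Q : HTensor K H →L[ℂ] HTensor K H) : Prop :=
  ∀ (F : Finset ι) (y : ι → H),
    HasSum (fun i => simpleTensor (e i) (∑ j ∈ F, S i j (y j)))
      (Q (∑ j ∈ F, simpleTensor (e j) (y j)))

end Tensor

end HilbertSlicing

end

/-! Slicing: $T_{u,v}=J_u^*TJ_v$ with $\|J_u\|\le\|u\|$, so everything follows from the ideal
property $\|ATB\|_\mu\le\|A\|\,\|T\|_\mu\,\|B\|$ (`classENorm_comp_comp_le`), applied to $T$ and to
the tails of a series. Only the trace class needs work: polar decomposition gives
$T=(U|T|^{1/2})|T|^{1/2}$, and the trace norm of a product is bounded by Hilbert–Schmidt norms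
(`traceENorm_adjoint_comp_le`).

Stitching: $K\otimes H$ is the Hilbert sum of the subspaces $e_i\otimes H$, so $x=\sum_i e_i\otimes
J_{e_i}^*x$ (`hasSum_simpleTensor_adjoint`). For $x=T\sum_j e_j\otimes y_j$ the coefficients are
$\sum_j T_{ij}y_j$; density gives uniqueness. -/

namespace HilbertSlicing

open ContinuousLinearMap

universe u v w

/-! ### The ideal property of the three operator classes -/

section Ideal

set_option linter.unusedSectionVars false

variable {E E' F F' G : Type*}
  [NormedAddCommGroup E] [InnerProductSpace ℂ E] [CompleteSpace E]
  [NormedAddCommGroup E'] [InnerProductSpace ℂ E'] [CompleteSpace E']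
  [NormedAddCommGroup F] [InnerProductSpace ℂ F] [CompleteSpace F]
  [NormedAddCommGroup F'] [InnerProductSpace ℂ F'] [CompleteSpace F']
  [NormedAddCommGroup G] [InnerProductSpace ℂ G] [CompleteSpace G]

theorem enorm_adjoint (A : E →L[ℂ] F) : ‖adjoint A‖ₑ = ‖A‖ₑ := by
  rw [← ofReal_norm, ← ofReal_norm, LinearIsometryEquiv.norm_map]

theorem hsENorm_adjoint (A : E →L[ℂ] F) : hsENorm (adjoint A) = hsENorm A := by
  rw [hsENorm, hsENorm, ← tsum_enorm_adjoint (someBasis E) (someBasis F)]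

theorem hsENorm_comp_le (A : F →L[ℂ] G) (B : E →L[ℂ] F) :
    hsENorm (A ∘L B) ≤ ‖A‖ₑ * hsENorm B := by
  have h : ∑' i, ‖(A ∘L B) (someBasis E i)‖ₑ ^ 2
      ≤ ‖A‖ₑ ^ 2 * ∑' i, ‖B (someBasis E i)‖ₑ ^ 2 := by
    rw [← ENNReal.tsum_mul_left]
    refine ENNReal.tsum_le_tsum fun i => ?_
    rw [← mul_pow]
    gcongr
    exact A.le_opENorm _
  calc hsENorm (A ∘L B)
      ≤ (‖A‖ₑ ^ 2 * ∑' i, ‖B (someBasis E i)‖ₑ ^ 2) ^ (1 / 2 : ℝ) := by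
        unfold hsENorm; gcongr
    _ = ‖A‖ₑ * hsENorm B := by
        rw [ENNReal.mul_rpow_of_nonneg _ _ (by norm_num), ← ENNReal.rpow_natCast,
          ← ENNReal.rpow_mul]
        norm_num [hsENorm]

/-- Adjoints preserve both norms and reverse products, which reduces this to `hsENorm_comp_le`. -/
theorem hsENorm_comp_le' (A : F →L[ℂ] G) (B : E →L[ℂ] F) :
    hsENorm (A ∘L B) ≤ hsENorm A * ‖B‖ₑ := by
  rw [← hsENorm_adjoint, adjoint_comp, ← hsENorm_adjoint A, ← enorm_adjoint B, mul_comm]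
  exact hsENorm_comp_le _ _

theorem opAbs_nonneg (A : E →L[ℂ] F) : 0 ≤ opAbs A := CFC.sqrt_nonneg _

theorem adjoint_opAbs (A : E →L[ℂ] F) : adjoint (opAbs A) = opAbs A :=
  (IsSelfAdjoint.of_nonneg (opAbs_nonneg A)).star_eq

theorem opAbs_comp_self (A : E →L[ℂ] F) : opAbs A ∘L opAbs A = adjoint A ∘L A :=
  CFC.sqrt_mul_sqrt_self _ (nonneg_iff_isPositive _ |>.2 (isPositive_adjoint_comp_self A))

theorem norm_opAbs_apply (A : E →L[ℂ] F) (x : E) : ‖opAbs A x‖ = ‖A x‖ := by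
  have h : inner ℂ (opAbs A x) (opAbs A x) = inner ℂ (A x) (A x) := by
    rw [← adjoint_inner_right, adjoint_opAbs, ← adjoint_inner_right A]
    exact congrArg (inner ℂ x) (congrArg (fun f : E →L[ℂ] E => f x) (opAbs_comp_self A))
  rw [← sq_eq_sq₀ (norm_nonneg _) (norm_nonneg _), ← inner_self_eq_norm_sq (𝕜 := ℂ),
    ← inner_self_eq_norm_sq (𝕜 := ℂ), h]

/-- Polar decomposition: `A = U |A|` and `U* A = |A|` for a contraction `U`. -/
theorem exists_polar (A : E →L[ℂ] F) :
    ∃ U : E →L[ℂ] F, ‖U‖ ≤ 1 ∧ U ∘L opAbs A = A ∧ adjoint U ∘L A = opAbs A := by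
  set P := opAbs A with hP
  set M : Submodule ℂ E := P.range.topologicalClosure with hM
  have hmem : ∀ x, P x ∈ M := fun x => P.range.le_topologicalClosure ⟨x, rfl⟩
  let e : E →ₗ[ℂ] M := P.toLinearMap.codRestrict M hmem
  have he : DenseRange e := by
    rw [DenseRange, dense_iff_closure_eq, Topology.IsInducing.subtypeVal.closure_eq_preimage_closure_image,
      ← Set.range_comp, Set.eq_univ_iff_forall]
    exact fun x => x.2
  have hle : ∀ x, ‖A.toLinearMap x‖ ≤ 1 * ‖e x‖ := fun x => by
    rw [one_mul]; exact (norm_opAbs_apply A x).ge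
  have : CompleteSpace M := (Submodule.isClosed_topologicalClosure _).completeSpace_coe
  -- $|A|x\mapsto Ax$ is isometric on the range of $|A|$; extend it to the closure $M$, and by $0$
  -- on $M^\perp$.
  set U : E →L[ℂ] F := (A.toLinearMap.extendOfNorm e) ∘L M.orthogonalProjectionOnto with hU
  have hUP : ∀ x, U (P x) = A x := fun x => by
    have h1 : M.orthogonalProjectionOnto (P x) = e x :=
      Submodule.orthogonalProjectionOnto_mem_subspace_eq_self (e x)
    rw [hU, comp_apply, h1, LinearMap.extendOfNorm_eq he ⟨1, hle⟩]; rfl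
  have hU1 : ‖U‖ ≤ 1 := by
    refine (opNorm_comp_le _ _).trans ?_
    refine mul_le_one₀ (LinearMap.opNorm_extendOfNorm_le he zero_le_one hle) (norm_nonneg _)
      M.orthogonalProjectionOnto_norm_le
  refine ⟨U, hU1, ContinuousLinearMap.ext hUP, ContinuousLinearMap.ext fun x => ?_⟩
  -- Since $\langle U^*Ax,|A|x\rangle=\|Ax\|^2$, the square $\|U^*Ax-|A|x\|^2$ equals
  -- $\|U^*Ax\|^2-\|Ax\|^2\le0$.
  rw [comp_apply, ← sub_eq_zero, ← norm_eq_zero, ← sq_eq_zero_iff]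
  refine le_antisymm ?_ (sq_nonneg _)
  rw [norm_sub_sq (𝕜 := ℂ), adjoint_inner_left, hUP, inner_self_eq_norm_sq, hP,
    norm_opAbs_apply]
  have h2 : ‖adjoint U (A x)‖ ≤ ‖A x‖ :=
    (le_opNorm _ _).trans (mul_le_of_le_one_left (norm_nonneg _)
      (by rwa [LinearIsometryEquiv.norm_map]))
  nlinarith [norm_nonneg (adjoint U (A x)), norm_nonneg (A x)]

theorem tsum_enorm_mul_le {ι : Type*} (f g : ι → ℝ≥0∞) :
    ∑' i, f i * g i ≤ (∑' i, f i ^ 2) ^ (1 / 2 : ℝ) * (∑' i, g i ^ 2) ^ (1 / 2 : ℝ) := by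
  rw [ENNReal.tsum_eq_iSup_sum]
  refine iSup_le fun s => ?_
  refine (ENNReal.inner_le_Lp_mul_Lq s f g Real.HolderConjugate.two_two).trans ?_
  simp only [ENNReal.rpow_two]
  gcongr <;> exact ENNReal.sum_le_tsum s

/-- With $U$ from the polar decomposition, $|X^*Y|=(XU)^*Y$, so the trace is a sum of $\langle
XUe_i,Ye_i\rangle$, to which Cauchy–Schwarz applies. -/
theorem traceENorm_adjoint_comp_le (X : F →L[ℂ] G) (Y : E →L[ℂ] G) :
    traceENorm (adjoint X ∘L Y) ≤ hsENorm X * hsENorm Y := by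
  obtain ⟨U, hU, -, hUA⟩ := exists_polar (adjoint X ∘L Y)
  have hXU : hsENorm (X ∘L U) ≤ hsENorm X := by
    refine (hsENorm_comp_le' X U).trans (mul_le_of_le_one_right' ?_)
    rw [← ofReal_norm]
    exact ENNReal.ofReal_le_one.2 hU
  refine le_trans ?_ (mul_le_mul_left hXU _)
  refine le_trans (ENNReal.tsum_le_tsum fun i => ?_) (tsum_enorm_mul_le _ _)
  rw [← hUA, comp_apply, comp_apply, adjoint_inner_right, adjoint_inner_right,
    ← ofReal_norm, ← ofReal_norm, ← ENNReal.ofReal_mul (norm_nonneg _)]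
  exact ENNReal.ofReal_le_ofReal ((RCLike.re_le_norm _).trans (norm_inner_le_norm _ _))

theorem traceENorm_eq_hsENorm_sqrt (A : E →L[ℂ] F) :
    traceENorm A = hsENorm (CFC.sqrt (opAbs A)) * hsENorm (CFC.sqrt (opAbs A)) := by
  set R : E →L[ℂ] E := CFC.sqrt (opAbs A) with hR
  have hRR : R * R = opAbs A := CFC.sqrt_mul_sqrt_self (opAbs A) (opAbs_nonneg A)
  have hRs : adjoint R = R := (IsSelfAdjoint.of_nonneg (CFC.sqrt_nonneg (opAbs A))).star_eq
  have key : ∀ x : E, ENNReal.ofReal (RCLike.re (inner ℂ x (opAbs A x))) = ‖R x‖ₑ ^ 2 := by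
    intro x
    rw [← hRR, mul_apply_eq_comp, ← adjoint_inner_left, hRs,
      inner_self_eq_norm_sq, ENNReal.ofReal_pow (norm_nonneg _), ofReal_norm]
  rw [hsENorm, ← ENNReal.rpow_add_of_nonneg _ _ (by norm_num) (by norm_num)]
  norm_num only [traceENorm, key, ENNReal.rpow_one]

theorem traceENorm_comp_comp_le (A : F →L[ℂ] F') (T : E →L[ℂ] F) (B : E' →L[ℂ] E) :
    traceENorm (A ∘L T ∘L B) ≤ ‖A‖ₑ * traceENorm T * ‖B‖ₑ := by
  obtain ⟨U, hU, hUT, -⟩ := exists_polar T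
  set R : E →L[ℂ] E := CFC.sqrt (opAbs T) with hR
  have hRR : R ∘L R = opAbs T := CFC.sqrt_mul_sqrt_self (opAbs T) (opAbs_nonneg T)
  -- $T=URR$ splits the product into $AUR$ and $RB$; the double adjoint gives it the form $X^*Y$.
  have hfac : A ∘L T ∘L B = adjoint (adjoint (A ∘L U ∘L R)) ∘L (R ∘L B) := by
    rw [adjoint_adjoint, ← hUT, ← hRR]; rfl
  have hU' : ‖U‖ₑ ≤ 1 := by
    rw [← ofReal_norm]; exact ENNReal.ofReal_le_one.2 hU
  rw [hfac, traceENorm_eq_hsENorm_sqrt T]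
  refine (traceENorm_adjoint_comp_le _ _).trans ?_
  rw [hsENorm_adjoint]
  calc hsENorm (A ∘L U ∘L R) * hsENorm (R ∘L B)
      ≤ (‖A‖ₑ * (1 * hsENorm R)) * (hsENorm R * ‖B‖ₑ) := by
        gcongr
        · refine (hsENorm_comp_le _ _).trans ?_
          gcongr
          refine (hsENorm_comp_le _ _).trans ?_
          gcongr
        · exact hsENorm_comp_le' _ _
    _ = _ := by rw [one_mul]; ring

theorem classENorm_comp_comp_le (μ : OperatorClass) (A : F →L[ℂ] F') (T : E →L[ℂ] F)
    (B : E' →L[ℂ] E) : classENorm μ (A ∘L T ∘L B) ≤ ‖A‖ₑ * classENorm μ T * ‖B‖ₑ := by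
  cases μ with
  | traceClass => exact traceENorm_comp_comp_le A T B
  | hilbertSchmidt =>
    refine (hsENorm_comp_le _ _).trans ?_
    rw [mul_assoc]
    exact mul_le_mul_right (hsENorm_comp_le' _ _) _
  | bounded =>
    refine (opENorm_comp_le _ _).trans ?_
    rw [mul_assoc]
    exact mul_le_mul_right (opENorm_comp_le _ _) _

end Ideal

/-! ### Slices and expansion along an orthonormal basis of $K$ -/

section Tensor

set_option linter.unusedSectionVars false

variable {K : Type u} [NormedAddCommGroup K] [InnerProductSpace ℂ K] [CompleteSpace K]
variable {H : Type v} [NormedAddCommGroup H] [InnerProductSpace ℂ H] [CompleteSpace H]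

theorem inner_simpleTensor (x x' : K) (y y' : H) :
    inner ℂ (simpleTensor x y) (simpleTensor x' y') = inner ℂ x x' * inner ℂ y y' := by
  rw [simpleTensor, simpleTensor, UniformSpace.Completion.inner_coe, TensorProduct.inner_tmul]

theorem norm_simpleTensor (x : K) (y : H) : ‖simpleTensor x y‖ = ‖x‖ * ‖y‖ := by
  rw [simpleTensor, UniformSpace.Completion.norm_coe, TensorProduct.norm_tmul]

theorem enorm_tensorLeft_le (u : K) : ‖(tensorLeft u : H →L[ℂ] HTensor K H)‖ₑ ≤ ‖u‖ₑ := by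
  rw [← ofReal_norm, ← ofReal_norm]
  refine ENNReal.ofReal_le_ofReal (opNorm_le_bound _ (norm_nonneg _) fun y => ?_)
  rw [tensorLeft_apply, norm_simpleTensor]

theorem tensorLeft_add_smul (a b : ℂ) (u u' : K) :
    (tensorLeft (a • u + b • u') : H →L[ℂ] HTensor K H)
      = a • tensorLeft u + b • tensorLeft u' := by
  simp only [tensorLeft, map_add, map_smul, comp_add, comp_smul]

theorem inner_slice (T : HTensor K H →L[ℂ] HTensor K H) (u v : K) (η ξ : H) :
    inner ℂ ξ (slice T u v η) = inner ℂ (simpleTensor u ξ) (T (simpleTensor v η)) := by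
  rw [slice, comp_apply, adjoint_inner_right]; rfl

theorem classENorm_slice_le (μ : OperatorClass) (T : HTensor K H →L[ℂ] HTensor K H) (u v : K) :
    classENorm μ (slice T u v) ≤ ‖u‖ₑ * classENorm μ T * ‖v‖ₑ := by
  refine (classENorm_comp_comp_le μ _ T _).trans ?_
  rw [enorm_adjoint]
  gcongr <;> exact enorm_tensorLeft_le _

theorem MemClass.slice {μ : OperatorClass} {T : HTensor K H →L[ℂ] HTensor K H}
    (hT : MemClass μ T) (u v : K) : MemClass μ (slice T u v) :=
  (classENorm_slice_le μ T u v).trans_lt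
    (ENNReal.mul_lt_top (ENNReal.mul_lt_top enorm_lt_top hT) enorm_lt_top)

theorem classNorm_slice_le {μ : OperatorClass} {T : HTensor K H →L[ℂ] HTensor K H}
    (hT : MemClass μ T) (u v : K) :
    classNorm μ (HilbertSlicing.slice T u v) ≤ classNorm μ T * ‖u‖ * ‖v‖ := by
  have h := ENNReal.toReal_mono
    (ENNReal.mul_lt_top (ENNReal.mul_lt_top enorm_lt_top hT) enorm_lt_top).ne
    (classENorm_slice_le μ T u v)
  rw [ENNReal.toReal_mul, ENNReal.toReal_mul, toReal_enorm, toReal_enorm] at h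
  rw [mul_comm (classNorm μ T)]
  exact h

theorem slice_sub_sum (T : HTensor K H →L[ℂ] HTensor K H)
    (T' : ℕ → HTensor K H →L[ℂ] HTensor K H) (s : Finset ℕ) (u v : K) :
    slice T u v - ∑ n ∈ s, slice (T' n) u v = slice (T - ∑ n ∈ s, T' n) u v := by
  ext x
  simp [slice]

theorem SeriesConverges.slice {μ : OperatorClass} {T : HTensor K H →L[ℂ] HTensor K H}
    {T' : ℕ → HTensor K H →L[ℂ] HTensor K H} (h : SeriesConverges μ T' T) (u v : K) :
    SeriesConverges μ (fun n => slice (T' n) u v) (slice T u v) := by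
  unfold SeriesConverges at h ⊢
  simp only [slice_sub_sum]
  have h2 : Filter.Tendsto (fun N => ‖u‖ₑ * classENorm μ (T - ∑ n ∈ Finset.range N, T' n) * ‖v‖ₑ)
      Filter.atTop (nhds 0) := by
    have h3 := ENNReal.Tendsto.mul_const (b := ‖v‖ₑ)
      (ENNReal.Tendsto.const_mul (a := ‖u‖ₑ) h (Or.inr enorm_ne_top)) (Or.inr enorm_ne_top)
    simpa using h3
  exact tendsto_of_tendsto_of_tendsto_of_le_of_le tendsto_const_nhds h2 (fun _ => zero_le)
    fun N => classENorm_slice_le μ _ u v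

/-- For fixed $y$ the map $x\mapsto x\otimes y$ is continuous, so density of the span of $e$ puts
all simple tensors in the closure; their sums are dense in the completion. -/
theorem dense_span_basis_tensor {ι : Type w} (e : HilbertBasis ι ℂ K) :
    Dense (Submodule.span ℂ {z : HTensor K H | ∃ j y, z = simpleTensor (e j) y} :
      Set (HTensor K H)) := by
  set M := Submodule.span ℂ {z : HTensor K H | ∃ j y, z = simpleTensor (e j) y}
  have hsimple : ∀ (x : K) (y : H), simpleTensor x y ∈ M.topologicalClosure := by
    intro x y
    let f : K →L[ℂ] HTensor K H :=
      UniformSpace.Completion.toComplL ∘L (TensorProduct.mkL ℂ K H).flip y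
    have hf : ∀ x, f x = simpleTensor x y := fun _ => rfl
    have hx : x ∈ (Submodule.span ℂ (Set.range e)).topologicalClosure :=
      e.dense_span ▸ Submodule.mem_top
    have hle : Submodule.span ℂ (Set.range e) ≤ M.comap f.toLinearMap := by
      rw [Submodule.span_le]
      rintro _ ⟨j, rfl⟩
      exact Submodule.subset_span ⟨j, y, rfl⟩
    rw [← hf]
    exact map_mem_closure f.continuous hx fun z hz => hle hz
  have hcoe : ∀ z : K ⊗[ℂ] H, (z : HTensor K H) ∈ M.topologicalClosure := by
    intro z
    induction z with
    | zero => rw [UniformSpace.Completion.coe_zero]; exact zero_mem _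
    | tmul x y => exact hsimple x y
    | add a b ha hb => rw [UniformSpace.Completion.coe_add]; exact add_mem ha hb
  rw [dense_iff_closure_eq, Set.eq_univ_iff_forall]
  intro z
  have hcl : IsClosed (M.topologicalClosure : Set (HTensor K H)) := M.isClosed_topologicalClosure
  exact UniformSpace.Completion.induction_on z hcl hcoe

/-- Every vector of `K ⊗ H` is `∑ᵢ eᵢ ⊗ J_{eᵢ}* x`. -/
theorem hasSum_simpleTensor_adjoint {ι : Type w} (e : HilbertBasis ι ℂ K) (x : HTensor K H) :
    HasSum (fun i => simpleTensor (e i) (adjoint (tensorLeft (e i)) x)) x := by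
  let V : ι → H →ₗᵢ[ℂ] HTensor K H := fun i =>
    { (tensorLeft (e i) : H →L[ℂ] HTensor K H).toLinearMap with
      norm_map' := fun y => by
        change ‖simpleTensor (e i) y‖ = _
        rw [norm_simpleTensor, e.orthonormal.1 i, one_mul] }
  have hV : ∀ i y, V i y = simpleTensor (e i) y := fun _ _ => rfl
  have hort : OrthogonalFamily ℂ (fun _ : ι => H) V := by
    intro i j hij a b
    rw [hV, hV, inner_simpleTensor, e.orthonormal.2 hij, zero_mul]
  have hsum : IsHilbertSum ℂ (fun _ : ι => H) V := by
    refine IsHilbertSum.mk hort ?_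
    rintro z -
    refine closure_mono ?_ (dense_span_basis_tensor e z)
    refine Submodule.span_le.2 ?_
    rintro _ ⟨j, y, rfl⟩
    exact Submodule.mem_iSup_of_mem j ⟨y, rfl⟩
  have hx := hsum.hasSum_linearIsometryEquiv_symm (hsum.linearIsometryEquiv x)
  rw [LinearIsometryEquiv.symm_apply_apply] at hx
  set w := hsum.linearIsometryEquiv x
  -- Pairing the expansion of $x$ with $e_i\otimes y$ leaves only the $i$-th term, $\langle
  -- y,w_i\rangle$.
  have hw : ∀ i, adjoint (tensorLeft (e i)) x = w i := by
    intro i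
    refine ext_inner_left ℂ fun y => ?_
    rw [adjoint_inner_right, tensorLeft_apply]
    have h1 := hx.mapL (innerSL ℂ (simpleTensor (e i) y))
    refine h1.unique ?_
    have h2 := hasSum_single (f := fun j => innerSL ℂ (simpleTensor (e i) y) (V j (w j))) i
      (fun j hj => by
        rw [innerSL_apply_apply, hV, inner_simpleTensor, e.orthonormal.2 hj.symm, zero_mul])
    rwa [innerSL_apply_apply, hV, inner_simpleTensor, inner_self_eq_norm_sq_to_K,
      e.orthonormal.1 i, RCLike.ofReal_one, one_pow, one_mul] at h2
  simpa only [hw, hV] using hx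

theorem isStitching_slice {ι : Type w} (e : HilbertBasis ι ℂ K)
    (T : HTensor K H →L[ℂ] HTensor K H) :
    IsStitching e (fun i j => slice T (e i) (e j)) T := by
  intro F y
  have h := hasSum_simpleTensor_adjoint e (T (∑ j ∈ F, simpleTensor (e j) (y j)))
  simp only [map_sum] at h ⊢
  exact h

theorem IsStitching.unique {ι : Type w} {e : HilbertBasis ι ℂ K} {S : ι → ι → H →L[ℂ] H}
    {Q Q' : HTensor K H →L[ℂ] HTensor K H} (hQ : IsStitching e S Q) (hQ' : IsStitching e S Q') :
    Q = Q' := by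
  refine ContinuousLinearMap.ext_on (dense_span_basis_tensor e) ?_
  rintro _ ⟨j, y, rfl⟩
  -- One-element sums already determine the operator on each $e_j\otimes y$.
  have h := (hQ {j} fun _ => y).unique (hQ' {j} fun _ => y)
  simpa only [Finset.sum_singleton] using h

end Tensor

end HilbertSlicing

open HilbertSlicing in
theorem mainTheorem10
    {K : Type*} [NormedAddCommGroup K] [InnerProductSpace ℂ K] [CompleteSpace K]
    {H : Type*} [NormedAddCommGroup H] [InnerProductSpace ℂ H] [CompleteSpace H]
    (μ : OperatorClass) (T : HTensor K H →L[ℂ] HTensor K H) (hT : MemClass μ T) :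
    -- the sesquilinear identity defines a unique map `T_{u,v}`, namely `J_u* T J_v`
    (∀ (u v : K) (S : H → H),
      (∀ η ξ : H, inner ℂ ξ (S η) = inner ℂ (simpleTensor u ξ) (T (simpleTensor v η))) ↔
        S = slice T u v) ∧
    -- slices lie in the class, with the norm bound
    (∀ u v : K, MemClass μ (slice T u v) ∧
      classNorm μ (slice T u v) ≤ classNorm μ T * ‖u‖ * ‖v‖) ∧
    -- conjugate-linear in `u`, linear in `v`, jointly bounded
    (∀ (a b : ℂ) (u u' v : K),
      slice T (a • u + b • u') v = conj a • slice T u v + conj b • slice T u' v) ∧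
    (∀ (a b : ℂ) (u v v' : K),
      slice T u (a • v + b • v') = a • slice T u v + b • slice T u v') ∧
    (∃ C : ℝ, ∀ u v : K, classNorm μ (slice T u v) ≤ C * ‖u‖ * ‖v‖) ∧
    -- slicing respects series converging in the norm of the class
    (∀ T' : ℕ → HTensor K H →L[ℂ] HTensor K H, (∀ n, MemClass μ (T' n)) →
      SeriesConverges μ T' T →
      ∀ u v : K, (∀ n, MemClass μ (slice (T' n) u v)) ∧
        SeriesConverges μ (fun n => slice (T' n) u v) (slice T u v)) ∧
    -- stitching
    (∀ {ι : Type*} (e : HilbertBasis ι ℂ K),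
      IsStitching e (fun i j => slice T (e i) (e j)) T ∧
      ∀ Q : HTensor K H →L[ℂ] HTensor K H,
        IsStitching e (fun i j => slice T (e i) (e j)) Q →
          Q = T ∧ MemClass μ Q ∧ classNorm μ Q = classNorm μ T) := by
  refine ⟨fun u v S => ⟨fun h => ?_, ?_⟩, fun u v => ⟨hT.slice u v, classNorm_slice_le hT u v⟩,
    fun a b u u' v => ?_, fun a b u v v' => ?_, ⟨classNorm μ T, classNorm_slice_le hT⟩,
    fun T' hT' h u v => ⟨fun n => (hT' n).slice u v, h.slice u v⟩,
    fun e => ⟨isStitching_slice e T, fun Q hQ => ?_⟩⟩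
  · funext η
    exact ext_inner_left ℂ fun ξ => by rw [h, inner_slice]
  · rintro rfl η ξ
    exact inner_slice T u v η ξ
  -- The conjugates come from the adjoint of $J_u$, itself linear in $u$.
  · simp only [slice, tensorLeft_add_smul, map_add, map_smulₛₗ, ContinuousLinearMap.add_comp,
      ContinuousLinearMap.smul_comp]
  · simp only [slice, tensorLeft_add_smul, ContinuousLinearMap.comp_add,
      ContinuousLinearMap.comp_smul]
  · obtain rfl := hQ.unique (isStitching_slice e T)
    exact ⟨rfl, hT, rfl⟩
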